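/- Let $G$ be a countable sofic group. This means that there are maps (not necessarily homomorphisms) $\sigma_i : G \to \mathrm{Sym}(m_i)$, $m_i \ge 1$, increasing subsets $F_1 \subseteq F_2 \subseteq \cdots$ of $G$ with $\bigcup_i F_i = G$, and reals $\epsilon_i \to 0$, such that for every $i$ at least $(1-\epsilon_i) m_i$ of the points $v \in \{1,\dots,m_i\}$ satisfy, for all $f_1, f_2 \in F_i$, both $\sigma_i(f_1)\sigma_i(f_2) v = \sigma_i(f_1 f_2) v$ and $\sigma_i(f_1) v \neq \sigma_i(f_2) v$ if $f_1 \ne f_2$. For a standard Borel probability space $(K,\kappa)$, put $H(\kappa) = -\sum_{k \in K'} \kappa(\{k\}) \log \kappa(\{k\})$ (with $0 \log 0 = 0$) if there is a finite or countably infinite set $K' \subseteq K$ with $\kappa(K') = 1$, and $H(\kappa) = +\infty$ otherwise. The Bernoulli shift $(G, K^G, \kappa^G)$ is the space $K^G$ of all functions $x : G \to K$, with the product measure $\kappa^G$ and the action $(g x)(f) = x(g^{-1} f)$ for $g, f \in G$. Two systems $(G_1, X_1, \mu_1)$ and $(G_2, X_2, \mu_2)$ are conjugate up to automorphisms if there are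 a group isomorphism $\Phi : G_1 \to G_2$, conull sets $X_1' \subseteq X_1$ and $X_2' \subseteq X_2$ with $X_1'$ being $G_1$-invariant, and an isomorphism of measure spaces $\phi : X_1' \to X_2'$ such that $\phi(g x) = \Phi(g)\phi(x)$ for all $g \in G_1$ and $x \in X_1'$. **Theorem.** Let $G$ be a countable sofic group and let $(K_1, \kappa_1)$, $(K_2, \kappa_2)$ be standard Borel probability spaces such that $H(\kappa_1) + H(\kappa_2) < \infty$. If $(G, K_1^G, \kappa_1^G)$ is conjugate up to automorphisms to $(G, K_2^G, \kappa_2^G)$, then $H(\kappa_1) = H(\kappa_2)$. -/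

import Mathlib

open MeasureTheory Filter Topology
open scoped ENNReal

/-! ### Sofic groups -/

/-- For a map `σ : G → Sym(m)` (not assumed to be a homomorphism) and `F ⊆ G`, the set `V(F)` of
all points `v` at which `σ` is multiplicative and free along `F`. -/
def soficGoodSet {G : Type*} [Group G] {m : ℕ} (σ : G → Equiv.Perm (Fin m)) (F : Set G) :
    Set (Fin m) :=
  {v | ∀ f₁ ∈ F, ∀ f₂ ∈ F,
    σ f₁ (σ f₂ v) = σ (f₁ * f₂) v ∧ (f₁ ≠ f₂ → σ f₁ v ≠ σ f₂ v)}

/-- `σ : G → Sym(m)` is an `(F, ε)`-approximation to `G` if `|V(F)| ≥ (1 - ε) m`. -/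
def IsSoficApproxMap {G : Type*} [Group G] {m : ℕ} (σ : G → Equiv.Perm (Fin m)) (F : Set G)
    (ε : ℝ) : Prop :=
  (1 - ε) * (m : ℝ) ≤ ((soficGoodSet σ F).ncard : ℝ)

/-- The sequence `σ i : G → Sym(m i)` is a sofic approximation to `G`: each `σ i` is an
`(F i, ε i)`-approximation, where the sets `F i` increase to `G` and `ε i → 0`. -/
def IsSoficApproximation {G : Type*} [Group G] (m : ℕ → ℕ)
    (σ : ∀ i, G → Equiv.Perm (Fin (m i))) : Prop :=
  (∀ i, 1 ≤ m i) ∧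
  ∃ (F : ℕ → Set G) (ε : ℕ → ℝ),
    (∀ i, F i ⊆ F (i + 1)) ∧ (⋃ i, F i) = Set.univ ∧ Tendsto ε atTop (𝓝 0) ∧
    ∀ i, IsSoficApproxMap (σ i) (F i) (ε i)

/-- A (countable) group is sofic if it admits a sofic approximation. -/
def IsSofic (G : Type*) [Group G] : Prop :=
  ∃ (m : ℕ → ℕ) (σ : ∀ i, G → Equiv.Perm (Fin (m i))), IsSoficApproximation m σ

/-! ### Entropy of a probability measure -/

open Classical in
/-- The entropy `H(κ) ∈ [0, ∞]`: if `κ` is carried by a countable set, it is the sum of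
`- κ{k} log κ{k}` (points outside a countable carrier contribute `0`, see
`baseEntropy_eq_tsum`), and otherwise it is `∞`. -/
noncomputable def baseEntropy {K : Type*} [MeasurableSpace K] (κ : Measure K) : ℝ≥0∞ :=
  if ∃ K' : Set K, K'.Countable ∧ κ K' = 1 then
    ∑' k : K, ENNReal.ofReal (Real.negMulLog (κ.real {k}))
  else ⊤

/-- The entropy may be computed over any countable set of full measure. -/
theorem baseEntropy_eq_tsum {K : Type*} [MeasurableSpace K] [MeasurableSingletonClass K]
    (κ : Measure K) [IsProbabilityMeasure κ] (K' : Set K) (hc : K'.Countable) (h1 : κ K' = 1) :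
    baseEntropy κ = ∑' k : K', ENNReal.ofReal (Real.negMulLog (κ.real {(k : K)})) := by
  have h0 : κ K'ᶜ = 0 := (prob_compl_eq_zero_iff hc.measurableSet).2 h1
  rw [baseEntropy, if_pos ⟨K', hc, h1⟩]
  symm
  refine tsum_subtype_eq_of_support_subset
    (f := fun k : K => ENNReal.ofReal (Real.negMulLog (κ.real {k}))) ?_
  intro k hk
  by_contra hk'
  apply hk
  have : κ {k} = 0 := measure_mono_null (by simpa using hk') h0
  simp [Measure.real, this]

/-! ### Bernoulli shifts -/

/-- The space `K^G` of all functions `G → K`, on which `G` acts by the shift. -/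
def BernoulliSpace (G K : Type*) : Type _ := G → K

/-- The product measurable structure on `K^G`. -/
instance BernoulliSpace.instMeasurableSpace (G K : Type*) [MeasurableSpace K] :
    MeasurableSpace (BernoulliSpace G K) :=
  inferInstanceAs (MeasurableSpace (G → K))

/-- The shift action `(g x)(f) = x (g⁻¹ f)`. -/
instance BernoulliSpace.instMulAction (G K : Type*) [Group G] :
    MulAction G (BernoulliSpace G K) where
  smul g x := fun f => x (g⁻¹ * f)
  one_smul x := by
    funext f
    change x (1⁻¹ * f) = x f
    simp
  mul_smul g h x := by
    funext f
    change x ((g * h)⁻¹ * f) = x (h⁻¹ * (g⁻¹ * f))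
    simp [mul_assoc]

/-- The product measure `κ^G` on `K^G`. -/
noncomputable def bernoulliMeasure (G : Type*) {K : Type*} [MeasurableSpace K] (κ : Measure K)
    [IsProbabilityMeasure κ] : Measure (BernoulliSpace G K) :=
  Measure.infinitePi (fun _ : G => κ)

/-! ### Conjugacy up to automorphisms -/

/-- The systems `(G₁, X₁, μ₁)` and `(G₂, X₂, μ₂)` are conjugate up to automorphisms: there are a
group isomorphism `Φ : G₁ ≃* G₂`, conull sets `X₁' ⊆ X₁`, `X₂' ⊆ X₂` and an isomorphism of
measure spaces `φ : X₁' → X₂'` such that `φ (g x) = Φ(g) φ(x)` for all `g` and all `x ∈ X₁'`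
(in particular `g x ∈ X₁'`). The sets `X₁'`, `X₂'` carry the restricted measures. -/
def ConjugateUpToAutomorphisms (G₁ G₂ : Type*) [Group G₁] [Group G₂] {X₁ X₂ : Type*}
    [MeasurableSpace X₁] [MeasurableSpace X₂] [MulAction G₁ X₁] [MulAction G₂ X₂]
    (μ₁ : Measure X₁) (μ₂ : Measure X₂) : Prop :=
  ∃ (Φ : G₁ ≃* G₂) (X₁' : Set X₁) (X₂' : Set X₂) (φ : X₁' ≃ᵐ X₂'),
    μ₁ X₁'ᶜ = 0 ∧ μ₂ X₂'ᶜ = 0 ∧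
    MeasurePreserving φ (μ₁.comap Subtype.val) (μ₂.comap Subtype.val) ∧
    ∀ (g : G₁) (x : X₁'), ∃ h : g • (x : X₁) ∈ X₁',
      ((φ ⟨g • (x : X₁), h⟩ : X₂') : X₂) = Φ g • ((φ x : X₂') : X₂)

/-! By symmetry it suffices to bound a partial entropy of `κ₁`, over a finite set `Q` of atoms, by
H(κ₂). The conjugacy is given by its coordinate `ψ` at the identity. Up to small error, `ψ` is a
code `c` with finite window `W` and finitely many output letters, and the inverse is a decoder `f`
with finite window `T` that recovers the `Q`-letter at the identity.

On a sofic model `Fin m`, take i.i.d. `κ₁`-labels, with collapsed word X. Let Y be its coded word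
and dec the decoder acting on words. Gibbs' inequality compares the law of X with the weights q(s,
r) = ∏ w(r v) · ∏ ρ(s v, dec r v) on pairs of words, where `w` is `κ₂` on finitely many atoms and
`ρ` is nearly concentrated on the diagonal. Since q has total mass at most 1, m times the partial
entropy is at most the expectation of -log q(X, Y). This is a sum over vertices, so Y need not be
close to independent: only local laws matter. At a good vertex they agree with those of the
Bernoulli shift, where the `w` term is about H(κ₂) and the `ρ` term is small because decoding rarely
fails. Bad vertices have proportion at most ε and bounded cost. Divide by m.

The carriers are `integral_neg_log_le_of_sum_le_one`, `mul_integral_neg_log_le_of_code`,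
`ConjugateUpToAutomorphisms.exists_coordinate` and `sum_negMulLog_le_of_conjugate`. -/

/-! ### Product measures, Gibbs' inequality and finite-window approximation -/

section Preliminaries

/-- Pulling an i.i.d. family back along an injection of index sets gives an i.i.d. family. -/
theorem measurePreserving_infinitePi_comp {ι ι' K : Type*} [MeasurableSpace K] (κ : Measure K)
    [IsProbabilityMeasure κ] {j : ι' → ι} (hj : Function.Injective j) :
    MeasurePreserving (fun (x : ι → K) (i : ι') => x (j i))
      (Measure.infinitePi fun _ : ι => κ) (Measure.infinitePi fun _ : ι' => κ) := by
  classical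
  have hm : Measurable (fun (x : ι → K) (i : ι') => x (j i)) := by fun_prop
  refine ⟨hm, Measure.eq_infinitePi _ fun s t ht => ?_⟩
  rw [Measure.map_apply hm (.pi s.countable_toSet fun i _ => ht i)]
  let t' : ι → Set K := fun i => if h : ∃ i', j i' = i then t h.choose else Set.univ
  have ht' : ∀ i, t' (j i) = t i := by
    intro i
    have h : ∃ i', j i' = j i := ⟨i, rfl⟩
    simp only [t', dif_pos h]
    rw [hj h.choose_spec]
  have hmt : ∀ i, MeasurableSet (t' i) := by
    intro i
    simp only [t']
    split_ifs with h
    · exact ht _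
    · exact .univ
  have : (fun (x : ι → K) (i : ι') => x (j i)) ⁻¹' Set.pi s t
      = Set.pi (s.image j : Finset ι) t' := by
    ext x
    simp [Set.mem_pi, ht']
  rw [this, Measure.infinitePi_pi _ (fun i _ => hmt i), Finset.prod_image (fun a _ b _ h => hj h)]
  simp [ht']

/-- The expectation of a function of a finitely valued random variable. -/
theorem integral_comp_eq_sum {Ω R : Type*} [MeasurableSpace Ω] (P : Measure Ω) [IsFiniteMeasure P]
    [Fintype R] [MeasurableSpace R] [MeasurableSingletonClass R] {y : Ω → R} (hy : Measurable y)
    (u : R → ℝ) : ∫ ω, u (y ω) ∂P = ∑ r, P.real (y ⁻¹' {r}) * u r := by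
  rw [← integral_map (f := u) hy.aemeasurable (measurable_of_finite u).aestronglyMeasurable,
    integral_fintype .of_finite]
  refine Finset.sum_congr rfl fun r _ => ?_
  rw [map_measureReal_apply hy (measurableSet_singleton r), smul_eq_mul]

theorem integrable_comp_of_finite {Ω R : Type*} [MeasurableSpace Ω] (P : Measure Ω)
    [IsFiniteMeasure P] [Finite R] [MeasurableSpace R] [MeasurableSingletonClass R] {y : Ω → R}
    (hy : Measurable y) (u : R → ℝ) : Integrable (fun ω => u (y ω)) P :=
  Integrable.comp_measurable (f := y) (g := u) .of_finite hy

/-- Gibbs' inequality, for a sub-probability `q` on pairs and a majorant `p` of the law of the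
first coordinate. -/
theorem integral_neg_log_le_of_sum_le_one {Ω S R : Type*} [MeasurableSpace Ω] (P : Measure Ω)
    [IsProbabilityMeasure P] [Fintype S] [MeasurableSpace S] [MeasurableSingletonClass S]
    [Fintype R] [MeasurableSpace R] [MeasurableSingletonClass R] {x : Ω → S} {y : Ω → R}
    (hx : Measurable x) (hy : Measurable y) {p : S → ℝ} {q : S → R → ℝ} (hp : ∀ s, 0 < p s)
    (hq : ∀ s r, 0 < q s r) (hxp : ∀ s, P.real (x ⁻¹' {s}) ≤ p s)
    (hq1 : ∑ r, ∑ s, q s r ≤ 1) :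
    ∫ ω, -Real.log (p (x ω)) ∂P ≤ ∫ ω, -Real.log (q (x ω) (y ω)) ∂P := by
  have hxy : Measurable fun ω => (x ω, y ω) := hx.prodMk hy
  have i1 := integrable_comp_of_finite P hx fun s => -Real.log (p s)
  have i2 := integrable_comp_of_finite P hxy fun z => -Real.log (q z.1 z.2)
  have i3 := integrable_comp_of_finite P hxy fun z => q z.1 z.2 / p z.1
  -- A pair (s, r) has probability at most that of s, hence at most `p s`; this cancels the
  -- denominator and leaves the total mass of `q`.
  have hle : ∫ ω, q (x ω) (y ω) / p (x ω) ∂P ≤ 1 := by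
    rw [integral_comp_eq_sum P hxy fun z => q z.1 z.2 / p z.1, Fintype.sum_prod_type_right]
    refine le_trans (Finset.sum_le_sum fun r _ => Finset.sum_le_sum fun s _ => ?_) hq1
    have h1 : P.real ((fun ω => (x ω, y ω)) ⁻¹' {(s, r)}) ≤ p s := by
      refine le_trans (measureReal_mono ?_) (hxp s)
      intro ω hω
      simp only [Set.mem_preimage, Set.mem_singleton_iff, Prod.mk.injEq] at hω ⊢
      exact hω.1
    calc _ ≤ p s * (q s r / p s) :=
          mul_le_mul_of_nonneg_right h1 (div_nonneg (hq s r).le (hp s).le)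
      _ = q s r := by field_simp [(hp s).ne']
  have key : ∫ ω, (-Real.log (p (x ω)) - -Real.log (q (x ω) (y ω))) ∂P
      ≤ ∫ ω, (q (x ω) (y ω) / p (x ω) - 1) ∂P := by
    refine integral_mono (i1.sub i2) (i3.sub (integrable_const 1)) fun ω => ?_
    have := Real.log_le_sub_one_of_pos (div_pos (hq (x ω) (y ω)) (hp (x ω)))
    rw [Real.log_div (hq _ _).ne' (hp _).ne'] at this
    change -Real.log (p (x ω)) - -Real.log (q (x ω) (y ω)) ≤ q (x ω) (y ω) / p (x ω) - 1
    linarith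
  rw [integral_sub i1 i2, integral_sub i3 (integrable_const 1)] at key
  simp only [integral_const, probReal_univ, smul_eq_mul, mul_one] at key
  linarith

/-- Two finitely valued random variables that rarely differ have close expectations under a
nonnegative function bounded by `C`. -/
theorem integral_comp_le_add_of_ne {Ω R : Type*} [MeasurableSpace Ω] (P : Measure Ω)
    [IsFiniteMeasure P] [Finite R] [MeasurableSpace R] [MeasurableSingletonClass R]
    {y y' : Ω → R} (hy : Measurable y) (hy' : Measurable y') {u : R → ℝ} {C : ℝ}
    (h0 : ∀ r, 0 ≤ u r) (hC : ∀ r, u r ≤ C) :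
    ∫ ω, u (y ω) ∂P ≤ ∫ ω, u (y' ω) ∂P + C * P.real {ω | y ω ≠ y' ω} := by
  have hm : MeasurableSet {ω | y ω ≠ y' ω} := (measurableSet_eq_fun hy hy').compl
  have i1 := integrable_comp_of_finite P hy' u
  have i2 : Integrable (Set.indicator {ω | y ω ≠ y' ω} fun _ => C) P :=
    (integrable_const C).indicator hm
  have : ∫ ω, u (y ω) ∂P ≤ ∫ ω, (u (y' ω) + Set.indicator {ω | y ω ≠ y' ω} (fun _ => C) ω) ∂P := by
    refine integral_mono (integrable_comp_of_finite P hy u) (i1.add i2) fun ω => ?_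
    by_cases h : y ω = y' ω
    · simp [h]
    · have := h0 (y' ω)
      have := hC (y ω)
      simp only [Set.indicator, Set.mem_ofPred_eq, ne_eq, h, not_false_eq_true, if_true]
      linarith
  rw [integral_add i1 i2, integral_indicator_const _ hm, smul_eq_mul, mul_comm] at this
  exact this

/-- A finitely valued measurable function on a product space is approximated in measure by
measurable functions of finitely many coordinates. -/
theorem exists_dependsOn_measureReal_ne_lt {ι K A : Type*} [MeasurableSpace K]
    (μ : Measure (ι → K)) [IsProbabilityMeasure μ] [Finite A] [MeasurableSpace A]
    [MeasurableSingletonClass A] {g : (ι → K) → A} (hg : Measurable g) {ε : ℝ} (hε : 0 < ε) :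
    ∃ (W : Finset ι) (c : (ι → K) → A), Measurable c ∧ DependsOn c (W : Set ι) ∧
      μ.real {x | c x ≠ g x} < ε := by
  classical
  cases nonempty_fintype A
  obtain ⟨x0⟩ : Nonempty (ι → K) := nonempty_of_isProbabilityMeasure μ
  have : Nonempty A := ⟨g x0⟩
  have hd := Measure.MeasureDense.of_generateFrom_isSetAlgebra_finite μ
    (isSetAlgebra_measurableCylinders (α := fun _ : ι => K))
    generateFrom_measurableCylinders.symm
  have hN : (0 : ℝ) < Fintype.card A := by exact_mod_cast Fintype.card_pos
  have h1 : ∀ a : A, ∃ t ∈ measurableCylinders (fun _ : ι => K),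
      μ (symmDiff (g ⁻¹' {a}) t) < ENNReal.ofReal (ε / Fintype.card A) := fun a =>
    hd.approx _ (hg (measurableSet_singleton a)) (measure_ne_top _ _) _ (by positivity)
  choose t ht hμt using h1
  have h2 : ∀ a, ∃ (s : Finset ι) (S : Set (∀ _ : s, K)), MeasurableSet S ∧ t a = cylinder s S :=
    fun a => (mem_measurableCylinders _).1 (ht a)
  choose s S hS hts using h2
  -- The cylinders `t a` approximate the fibres of `g` but need not partition the space. The value
  -- is read off where exactly one contains the point and is arbitrary elsewhere; every disagreement
  -- with `g` lies in some symmetric difference.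
  let pick : Set A → A := fun D => if h : ∃ a, D = {a} then h.choose else Classical.arbitrary A
  have hpick : ∀ a, pick {a} = a := by
    intro a
    have h : ∃ b, ({a} : Set A) = {b} := ⟨a, rfl⟩
    simp only [pick, dif_pos h]
    exact (Set.singleton_injective h.choose_spec).symm
  refine ⟨Finset.univ.biUnion s, fun x => pick {a | x ∈ t a}, ?_, ?_, ?_⟩
  · refine (measurable_of_finite pick).comp ?_
    refine measurable_set_iff.2 fun a => ?_
    exact measurableSet_setOfPred.1 (MeasurableSet.of_mem_measurableCylinders (ht a))
  · intro x y hxy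
    have : ∀ a, x ∈ t a ↔ y ∈ t a := by
      intro a
      rw [hts a, mem_cylinder, mem_cylinder]
      have : (s a).restrict x = (s a).restrict y := by
        funext i
        exact hxy _ (Finset.mem_coe.2 (Finset.mem_biUnion.2 ⟨a, Finset.mem_univ _, i.2⟩))
      rw [this]
    simp only [this]
  · have hsub : {x | pick {a | x ∈ t a} ≠ g x} ⊆ ⋃ a, symmDiff (g ⁻¹' {a}) (t a) := by
      intro x hx
      by_contra hx'
      simp only [Set.mem_iUnion, not_exists, Set.mem_symmDiff, Set.mem_preimage,
        Set.mem_singleton_iff, not_or, not_and, not_not] at hx'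
      apply hx
      have : {a | x ∈ t a} = {g x} := by
        ext a
        exact ⟨fun h => ((hx' a).2 h).symm, fun h => (hx' a).1 h.symm⟩
      change pick {a | x ∈ t a} = g x
      rw [this, hpick]
    calc μ.real {x | pick {a | x ∈ t a} ≠ g x}
        ≤ μ.real (⋃ a, symmDiff (g ⁻¹' {a}) (t a)) := measureReal_mono hsub
      _ ≤ ∑ a, μ.real (symmDiff (g ⁻¹' {a}) (t a)) := measureReal_iUnion_fintype_le _
      _ < ∑ _a : A, ε / Fintype.card A := by
          refine Finset.sum_lt_sum_of_nonempty Finset.univ_nonempty fun a _ => ?_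
          exact (ENNReal.lt_ofReal_iff_toReal_lt (measure_ne_top _ _)).1 (hμt a)
      _ = ε := by
          rw [Finset.sum_const, Finset.card_univ, nsmul_eq_mul]
          field_simp

/-- A measurable function of the coordinates in `S` has the same law on any two i.i.d. families
once the coordinates in `S` are read off injectively. -/
theorem map_comp_infinitePi_of_injOn {ι ι' K R : Type*} [MeasurableSpace K] (κ : Measure K)
    [IsProbabilityMeasure κ] [MeasurableSpace R] {c : (ι → K) → R} (hc : Measurable c) {S : Set ι}
    (hS : DependsOn c S) {j : ι → ι'} (hj : Set.InjOn j S) :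
    (Measure.infinitePi fun _ : ι' => κ).map (fun x => c fun i => x (j i))
      = (Measure.infinitePi fun _ : ι => κ).map c := by
  classical
  obtain ⟨k0⟩ : Nonempty K := nonempty_of_isProbabilityMeasure κ
  -- `j` is injective only on `S`, so both sides are factored through labellings of `S`; the filler
  -- `k0` is invisible to `c`.
  let ext : (S → K) → ι → K := fun z i => if h : i ∈ S then z ⟨i, h⟩ else k0
  have hext : Measurable ext := by
    refine measurable_pi_lambda _ fun i => ?_
    by_cases h : i ∈ S
    · simp only [ext, dif_pos h]; fun_prop
    · simp only [ext, dif_neg h]; fun_prop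
  have h1 := measurePreserving_infinitePi_comp κ (j := fun s : S => j s) hj.injective
  have h2 := measurePreserving_infinitePi_comp κ (j := fun s : S => (s : ι)) Subtype.val_injective
  have e1 : (fun x : ι' → K => c fun i => x (j i)) = (c ∘ ext) ∘ fun x (s : S) => x (j s) := by
    funext x
    exact hS fun i hi => by simp [ext, hi]
  have e2 : c = (c ∘ ext) ∘ fun x (s : S) => x s := by
    funext x
    exact hS fun i hi => by simp [ext, hi]
  rw [e1, ← Measure.map_map (hc.comp hext) h1.measurable, h1.map_eq]
  conv_rhs => rw [e2]
  rw [← Measure.map_map (hc.comp hext) h2.measurable, h2.map_eq]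

theorem integral_comp_infinitePi_of_injOn {ι ι' K R : Type*} [MeasurableSpace K] (κ : Measure K)
    [IsProbabilityMeasure κ] [Finite R] [MeasurableSpace R] [MeasurableSingletonClass R]
    {c : (ι → K) → R} (hc : Measurable c) {S : Set ι} (hS : DependsOn c S) {j : ι → ι'}
    (hj : Set.InjOn j S) (u : R → ℝ) :
    ∫ x, u (c fun i => x (j i)) ∂(Measure.infinitePi fun _ : ι' => κ)
      = ∫ z, u (c z) ∂(Measure.infinitePi fun _ : ι => κ) := by
  rw [← integral_map (φ := c) hc.aemeasurable (measurable_of_finite u).aestronglyMeasurable,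
    ← map_comp_infinitePi_of_injOn κ hc hS hj, integral_map _
      (measurable_of_finite u).aestronglyMeasurable]
  exact Measurable.aemeasurable (hc.comp (by fun_prop))

end Preliminaries

/-! ### Coding an i.i.d. labelling of a sofic model -/

section FiniteModel

/-- The sum over words of a product of letter weights is the product of the sums. -/
theorem sum_pi_prod_le_one {I R : Type*} [Fintype I] [DecidableEq I] [Fintype R] {q : I → R → ℝ}
    (h0 : ∀ i r, 0 ≤ q i r) (h1 : ∀ i, ∑ r, q i r ≤ 1) : ∑ s : I → R, ∏ i, q i (s i) ≤ 1 := by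
  rw [← Fintype.prod_sum]
  exact Finset.prod_le_one (fun i _ => Finset.sum_nonneg fun r _ => h0 i r) fun i _ => h1 i

/-- The entropy inequality on a finite model. An i.i.d. labelling of `Fin m` is compared with the
weights coming from the code `c` and from the decoder `f`; the points where `σ` is a good
approximation contribute the expectations computed on the Bernoulli shift, the others a bounded
amount. -/
theorem mul_integral_neg_log_le_of_code {G K A B : Type*} [Group G] [MeasurableSpace K]
    (κ : Measure K) [IsProbabilityMeasure κ]
    [Fintype A] [MeasurableSpace A] [MeasurableSingletonClass A]
    [Fintype B] [MeasurableSpace B] [MeasurableSingletonClass B]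
    {a : K → A} (ha : Measurable a) {p : A → ℝ} (hp : ∀ s, 0 < p s)
    (hap : ∀ s, κ.real (a ⁻¹' {s}) ≤ p s)
    {w : B → ℝ} (hw : ∀ r, 0 < w r) (hw1 : ∑ r, w r ≤ 1)
    {ρ : A → A → ℝ} (hρ : ∀ s t, 0 < ρ s t) (hρ1 : ∀ t, ∑ s, ρ s t ≤ 1)
    {C L : ℝ} (hC : ∀ r, -Real.log (w r) ≤ C) (hL : ∀ s t, -Real.log (ρ s t) ≤ L)
    {T W : Finset G} {c : (G → K) → B} (hc : Measurable c) (hcW : DependsOn c (W : Set G))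
    (f : (T → B) → A) {S : Set G} (hS1 : (1 : G) ∈ S) (hST : ∀ g ∈ T, g ∈ S)
    (hSW : ∀ h ∈ W, h ∈ S) (hSTW : ∀ g ∈ T, ∀ h ∈ W, g * h ∈ S)
    {m : ℕ} (σ : G → Equiv.Perm (Fin m)) {F : Set G} (hF : ∀ s ∈ S, s⁻¹ ∈ F) {ε : ℝ}
    (hσ : IsSoficApproxMap σ F ε) :
    m * ∫ k, -Real.log (p (a k)) ∂κ ≤
      m * (∫ z, -Real.log (w (c z)) ∂(Measure.infinitePi fun _ : G => κ) +
        ∫ z, -Real.log (ρ (a (z 1)) (f fun g : T => c fun h => z (g * h)))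
          ∂(Measure.infinitePi fun _ : G => κ)) + ε * m * (C + L) := by
  classical
  set μ := Measure.infinitePi fun _ : G => κ with hμ
  set P := Measure.infinitePi fun _ : Fin m => κ with hP
  set α := ∫ z, -Real.log (w (c z)) ∂μ with hα
  set β := ∫ z, -Real.log (ρ (a (z 1)) (f fun g : T => c fun h => z (g * h))) ∂μ with hβ
  have hA : Nonempty A := ⟨a (nonempty_of_isProbabilityMeasure κ).some⟩
  have hwle : ∀ r, w r ≤ 1 := fun r =>
    (Finset.single_le_sum (fun r _ => (hw r).le) (Finset.mem_univ r)).trans hw1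
  have hρle : ∀ s t, ρ s t ≤ 1 := fun s t =>
    (Finset.single_le_sum (f := fun s => ρ s t) (fun s _ => (hρ s t).le)
      (Finset.mem_univ s)).trans (hρ1 t)
  have hwn : ∀ r, 0 ≤ -Real.log (w r) := fun r =>
    neg_nonneg.2 (Real.log_nonpos (hw r).le (hwle r))
  have hρn : ∀ s t, 0 ≤ -Real.log (ρ s t) := fun s t =>
    neg_nonneg.2 (Real.log_nonpos (hρ s t).le (hρle s t))
  have hα0 : 0 ≤ α := integral_nonneg fun z => hwn _
  have hβ0 : 0 ≤ β := integral_nonneg fun z => hρn _ _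
  -- The labelling seen from `v`. With the inverse, moving the base point to `σ g⁻¹ v` becomes the
  -- translation z ↦ z(g ·) wherever `σ` is multiplicative.
  let pull : Fin m → (Fin m → K) → G → K := fun v x h => x (σ h⁻¹ v)
  have hpull : ∀ v, Measurable (pull v) := fun v => by
    simp only [pull]; fun_prop
  let X : (Fin m → K) → Fin m → A := fun x v => a (x v)
  let Y : (Fin m → K) → Fin m → B := fun x v => c (pull v x)
  let dec : (Fin m → B) → Fin m → A := fun y v => f fun g : T => y (σ (g : G)⁻¹ v)
  have hX : Measurable X := by simp only [X]; fun_prop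
  have hY : Measurable Y := measurable_pi_lambda _ fun v => hc.comp (hpull v)
  have hdec : ∀ v, Measurable fun x => dec (Y x) v := fun v =>
    (measurable_of_finite fun y => dec y v).comp hY
  have hXv : ∀ v, Measurable fun x => X x v := fun v => (measurable_pi_apply v).comp hX
  have hYv : ∀ v, Measurable fun x => Y x v := fun v => (measurable_pi_apply v).comp hY
  have hXd : ∀ v, Measurable fun x => (X x v, dec (Y x) v) := fun v => (hXv v).prodMk (hdec v)
  have gibbs := integral_neg_log_le_of_sum_le_one P hX hY (p := fun s => ∏ v, p (s v))
    (q := fun s r => (∏ v, w (r v)) * ∏ v, ρ (s v) (dec r v))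
    (fun s => Finset.prod_pos fun v _ => hp _)
    (fun s r => mul_pos (Finset.prod_pos fun v _ => hw _) (Finset.prod_pos fun v _ => hρ _ _))
    (by
      intro s
      have : X ⁻¹' {s} = Set.pi (Finset.univ : Finset (Fin m)) fun v => a ⁻¹' {s v} := by
        ext x
        simp [X, Set.mem_pi, funext_iff]
      rw [this, Measure.real, hP,
        Measure.infinitePi_pi _ fun v _ => ha (measurableSet_singleton _), ENNReal.toReal_prod]
      exact Finset.prod_le_prod (fun v _ => ENNReal.toReal_nonneg) fun v _ => hap _)
    (by
      simp_rw [← Finset.mul_sum]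
      refine le_trans (Finset.sum_le_sum fun r _ => mul_le_of_le_one_right
        (Finset.prod_nonneg fun v _ => (hw _).le) ?_)
        (sum_pi_prod_le_one (fun _ r => (hw r).le) fun _ => hw1)
      exact sum_pi_prod_le_one (q := fun v s => ρ s (dec r v)) (fun v s => (hρ _ _).le)
        fun v => hρ1 _)
  have hleft : ∫ x, -Real.log (∏ v, p (X x v)) ∂P = m * ∫ k, -Real.log (p (a k)) ∂κ := by
    have : ∀ x, -Real.log (∏ v, p (X x v)) = ∑ v, -Real.log (p (X x v)) := fun x => by
      rw [Real.log_prod fun v _ => (hp _).ne', Finset.sum_neg_distrib]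
    simp_rw [this]
    rw [integral_finsetSum _ fun v _ =>
      integrable_comp_of_finite P (hXv v) fun s => -Real.log (p s)]
    have : ∀ v, ∫ x, -Real.log (p (X x v)) ∂P = ∫ k, -Real.log (p (a k)) ∂κ := fun v => by
      rw [← (measurePreserving_eval_infinitePi (fun _ : Fin m => κ) v).map_eq,
        integral_map (measurable_pi_apply v).aemeasurable
          (((measurable_of_finite fun s => -Real.log (p s)).comp ha).aestronglyMeasurable)]
    simp [this]
  have hright : ∫ x, -Real.log ((∏ v, w (Y x v)) * ∏ v, ρ (X x v) (dec (Y x) v)) ∂P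
      = ∑ v, (∫ x, -Real.log (w (Y x v)) ∂P + ∫ x, -Real.log (ρ (X x v) (dec (Y x) v)) ∂P) := by
    have : ∀ x, -Real.log ((∏ v, w (Y x v)) * ∏ v, ρ (X x v) (dec (Y x) v))
        = ∑ v, (-Real.log (w (Y x v)) + -Real.log (ρ (X x v) (dec (Y x) v))) := fun x => by
      rw [Real.log_mul (Finset.prod_pos fun v _ => hw _).ne'
        (Finset.prod_pos fun v _ => hρ _ _).ne', Real.log_prod fun v _ => (hw _).ne',
        Real.log_prod fun v _ => (hρ _ _).ne', Finset.sum_add_distrib, Finset.sum_neg_distrib,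
        Finset.sum_neg_distrib]
      ring
    simp_rw [this]
    have i1 : ∀ v, Integrable (fun x => -Real.log (w (Y x v))) P := fun v =>
      integrable_comp_of_finite P (hYv v) fun r => -Real.log (w r)
    have i2 : ∀ v, Integrable (fun x => -Real.log (ρ (X x v) (dec (Y x) v))) P := fun v =>
      integrable_comp_of_finite P (hXd v) fun z => -Real.log (ρ z.1 z.2)
    refine (integral_finsetSum _ fun v _ => (i1 v).add (i2 v)).trans ?_
    exact Finset.sum_congr rfl fun v _ => integral_add (i1 v) (i2 v)
  rw [hleft, hright] at gibbs
  let good : Finset (Fin m) := Finset.univ.filter (· ∈ soficGoodSet σ F)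
  have hgood : ∀ v ∈ good,
      ∫ x, -Real.log (w (Y x v)) ∂P + ∫ x, -Real.log (ρ (X x v) (dec (Y x) v)) ∂P = α + β := by
    intro v hv
    have hv' : v ∈ soficGoodSet σ F := (Finset.mem_filter.1 hv).2
    -- Freeness at `v` makes the labels seen through the window `S` independent, as on the Bernoulli
    -- shift.
    have hinj : Set.InjOn (fun h : G => σ h⁻¹ v) S := by
      intro g hg h hh e
      by_contra hne
      exact (hv' _ (hF g hg) _ (hF h hh)).2 (fun e' => hne (inv_injective e')) e
    have h1F : (1 : G) ∈ F := by simpa using hF 1 hS1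
    -- Multiplicativity gives σ(1)σ(1)v = σ(1)v; cancel one factor.
    have hone : σ 1 v = v := (σ 1).injective (by simpa using (hv' 1 h1F 1 h1F).1)
    have hcS : DependsOn c S := fun x y h => hcW fun i hi => h i (hSW i hi)
    congr 1
    · exact integral_comp_infinitePi_of_injOn κ hc hcS hinj fun r => -Real.log (w r)
    · let D : (G → K) → A × A := fun z => (a (z 1), f fun g : T => c fun h => z (g * h))
      have hD : Measurable D := by
        refine (ha.comp (measurable_pi_apply 1)).prodMk ((measurable_of_finite f).comp ?_)
        refine measurable_pi_lambda _ fun g => hc.comp ?_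
        fun_prop
      have hDS : DependsOn D S := by
        intro x y h
        have h2 : ∀ g : T, c (fun h => x (g * h)) = c fun h => y (g * h) := fun g =>
          hcW fun i hi => h _ (hSTW g g.2 i hi)
        simp only [D, h 1 hS1, h2]
      -- Multiplicativity at `v` identifies decoding on the model with decoding on the group.
      have hXD : ∀ x, (X x v, dec (Y x) v) = D (pull v x) := by
        intro x
        have h2 : ∀ g : T, c (pull (σ (g : G)⁻¹ v) x) = c fun h => pull v x (g * h) := by
          intro g
          refine hcW fun i hi => ?_
          simp only [pull]
          rw [(hv' _ (hF i (hSW i hi)) _ (hF g (hST g g.2))).1, mul_inv_rev]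
        simp only [X, dec, Y, D, h2]
        simp [pull, hone]
      rw [hβ]
      refine Eq.trans ?_
        (integral_comp_infinitePi_of_injOn κ hD hDS hinj fun z => -Real.log (ρ z.1 z.2))
      refine integral_congr_ae (ae_of_all _ fun x => ?_)
      change _ = -Real.log (ρ (D (pull v x)).1 (D (pull v x)).2)
      rw [← hXD]
  have hbad : ∀ v,
      ∫ x, -Real.log (w (Y x v)) ∂P + ∫ x, -Real.log (ρ (X x v) (dec (Y x) v)) ∂P ≤ C + L := by
    intro v
    have b1 := integral_mono (integrable_comp_of_finite P (hYv v) fun r => -Real.log (w r))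
      (integrable_const C) fun x => hC _
    have b2 := integral_mono (integrable_comp_of_finite P (hXd v) fun z => -Real.log (ρ z.1 z.2))
      (integrable_const L) fun x => hL _ _
    simp only [integral_const, probReal_univ, smul_eq_mul, one_mul] at b1 b2
    exact add_le_add b1 b2
  have hcard : (good.card : ℝ) = ((soficGoodSet σ F).ncard : ℝ) := by
    rw [Set.ncard_eq_toFinset_card', ← Set.filter_mem_univ_eq_toFinset]
  have hcompl : (good.card : ℝ) + (goodᶜ.card : ℝ) = m := by
    have := good.card_add_card_compl
    rw [Fintype.card_fin] at this
    exact_mod_cast this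
  unfold IsSoficApproxMap at hσ
  rw [← hcard] at hσ
  rw [← Finset.sum_add_sum_compl good, Finset.sum_congr rfl hgood] at gibbs
  have hbad' := Finset.sum_le_card_nsmul goodᶜ _ (C + L) fun v _ => hbad v
  rw [nsmul_eq_mul] at hbad'
  rw [Finset.sum_const, nsmul_eq_mul] at gibbs
  rcases Nat.eq_zero_or_pos m with rfl | hm
  · simp
  have hCL : 0 ≤ C + L := by
    have v : Fin m := ⟨0, hm⟩
    have x : Fin m → K := fun _ => (nonempty_of_isProbabilityMeasure κ).some
    exact add_nonneg ((hwn (Y x v)).trans (hC _)) ((hρn hA.some hA.some).trans (hL _ _))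
  -- Nonnegativity of `α + β` allows all `m` vertices to be counted as good, so the bad ones only
  -- add an error.
  have h1 : (good.card : ℝ) * (α + β) ≤ m * (α + β) :=
    mul_le_mul_of_nonneg_right (by linarith [(Nat.cast_nonneg goodᶜ.card : (0 : ℝ) ≤ _)])
      (add_nonneg hα0 hβ0)
  have h2 : (goodᶜ.card : ℝ) * (C + L) ≤ ε * m * (C + L) :=
    mul_le_mul_of_nonneg_right (by linarith) hCL
  linarith

end FiniteModel

/-! ### From a conjugacy to an almost everywhere invertible equivariant map -/

section Conjugacy

/-- The conull sets of a conjugacy need not be measurable, but they are null measurable, and so are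
the images of their measurable subsets. -/
theorem comap_subtype_val_apply_of_compl_null {X : Type*} [MeasurableSpace X] {μ : Measure X}
    {s : Set X} (hs : μ sᶜ = 0) {t : Set s} (ht : MeasurableSet t) :
    μ.comap Subtype.val t = μ (Subtype.val '' t) := by
  have hs' : NullMeasurableSet s μ := by
    simpa using (NullMeasurableSet.of_null hs).compl
  exact Measure.comap_apply₀ _ _ Subtype.val_injective
    (fun u hu => Measure.MeasurableSet.nullMeasurableSet_subtype_coe hs' hu) ht.nullMeasurableSet

/-- Invariance of the second conull set is not part of the definition; it follows because g • y is
the image under φ of Φ⁻¹(g) • φ⁻¹(y). -/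
theorem ConjugateUpToAutomorphisms.symm {G₁ G₂ X₁ X₂ : Type*} [Group G₁] [Group G₂]
    [MeasurableSpace X₁] [MeasurableSpace X₂] [MulAction G₁ X₁] [MulAction G₂ X₂]
    {μ₁ : Measure X₁} {μ₂ : Measure X₂} (h : ConjugateUpToAutomorphisms G₁ G₂ μ₁ μ₂) :
    ConjugateUpToAutomorphisms G₂ G₁ μ₂ μ₁ := by
  obtain ⟨Φ, X₁', X₂', φ, h1, h2, hφ, heq⟩ := h
  refine ⟨Φ.symm, X₂', X₁', φ.symm, h2, h1, hφ.symm φ, fun g y => ?_⟩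
  obtain ⟨hx, e⟩ := heq (Φ.symm g) (φ.symm y)
  rw [Φ.apply_symm_apply, φ.apply_symm_apply] at e
  refine ⟨e ▸ Subtype.coe_prop _, ?_⟩
  have : (⟨g • (y : X₂), e ▸ Subtype.coe_prop _⟩ : X₂') = φ ⟨Φ.symm g • (φ.symm y : X₁), hx⟩ :=
    Subtype.ext e.symm
  rw [this, φ.symm_apply_apply]

/-- A conjugacy is realised by everywhere defined measurable maps, with the identities holding
almost everywhere. -/
theorem ConjugateUpToAutomorphisms.exists_measurePreserving {G₁ G₂ X₁ X₂ : Type*} [Group G₁]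
    [Group G₂] [MeasurableSpace X₁] [MeasurableSpace X₂] [MulAction G₁ X₁] [MulAction G₂ X₂]
    [Nonempty X₁] [Nonempty X₂] {μ₁ : Measure X₁} {μ₂ : Measure X₂}
    (hinv : ∀ g : G₁, MeasurePreserving (fun x : X₁ => g • x) μ₁ μ₁)
    (h : ConjugateUpToAutomorphisms G₁ G₂ μ₁ μ₂) :
    ∃ (Φ : G₁ ≃* G₂) (E : X₁ → X₂) (J : X₂ → X₁), MeasurePreserving E μ₁ μ₂ ∧ Measurable J ∧
      (∀ g, ∀ᵐ x ∂μ₁, E (g • x) = Φ g • E x) ∧ ∀ᵐ x ∂μ₁, J (E x) = x := by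
  classical
  obtain ⟨Φ, X₁', X₂', φ, h1, h2, hφ, heq⟩ := h
  -- Measurable null sets are removed so that the extensions by constants are measurable. Their
  -- complements need not be invariant, so equivariance survives only almost everywhere, for each
  -- group element.
  obtain ⟨N₁, hN₁, hN₁m, hN₁0⟩ := exists_measurable_superset_of_null h1
  obtain ⟨N₂, hN₂, hN₂m, hN₂0⟩ := exists_measurable_superset_of_null h2
  have s₁ : ∀ x ∈ N₁ᶜ, x ∈ X₁' := fun x hx => by_contra fun h => hx (hN₁ h)
  have s₂ : ∀ x ∈ N₂ᶜ, x ∈ X₂' := fun x hx => by_contra fun h => hx (hN₂ h)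
  obtain ⟨x0⟩ := ‹Nonempty X₁›
  obtain ⟨y0⟩ := ‹Nonempty X₂›
  let E : X₁ → X₂ := fun x => if h : x ∈ N₁ᶜ then (φ ⟨x, s₁ x h⟩ : X₂) else y0
  let J : X₂ → X₁ := fun y => if h : y ∈ N₂ᶜ then (φ.symm ⟨y, s₂ y h⟩ : X₁) else x0
  have hE : Measurable E := Measurable.dite (s := N₁ᶜ)
    (f := fun x : ↥(N₁ᶜ) => (φ ⟨x, s₁ x x.2⟩ : X₂)) (g := fun _ => y0)
    (measurable_subtype_coe.comp (φ.measurable.comp (measurable_subtype_coe.subtype_mk)))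
    measurable_const hN₁m.compl
  have hJ : Measurable J := Measurable.dite (s := N₂ᶜ)
    (f := fun x : ↥(N₂ᶜ) => (φ.symm ⟨x, s₂ x x.2⟩ : X₁)) (g := fun _ => x0)
    (measurable_subtype_coe.comp (φ.symm.measurable.comp (measurable_subtype_coe.subtype_mk)))
    measurable_const hN₂m.compl
  have ae₁ : ∀ᵐ x ∂μ₁, x ∈ N₁ᶜ := compl_mem_ae_iff.2 hN₁0
  have ae₂ : ∀ᵐ y ∂μ₂, y ∈ N₂ᶜ := compl_mem_ae_iff.2 hN₂0
  have hEφ : ∀ x (hx : x ∈ N₁ᶜ), E x = φ ⟨x, s₁ x hx⟩ := fun x hx => dif_pos hx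
  have hmp : MeasurePreserving E μ₁ μ₂ := by
    refine ⟨hE, Measure.ext fun s hs => ?_⟩
    have hs' : MeasurableSet (Subtype.val ⁻¹' s : Set X₂') := measurable_subtype_coe hs
    have e := hφ.measure_preimage hs'.nullMeasurableSet
    rw [comap_subtype_val_apply_of_compl_null h1 (φ.measurable hs'),
      comap_subtype_val_apply_of_compl_null h2 hs'] at e
    rw [Measure.map_apply hE hs]
    calc μ₁ (E ⁻¹' s) = μ₁ (Subtype.val '' (φ ⁻¹' (Subtype.val ⁻¹' s))) := by
          refine measure_congr ?_
          filter_upwards [ae₁] with x hx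
          refine propext ⟨fun h => ?_, ?_⟩
          · exact ⟨⟨x, s₁ x hx⟩, show (φ ⟨x, s₁ x hx⟩ : X₂) ∈ s from hEφ x hx ▸ h, rfl⟩
          · rintro ⟨x', hx', rfl⟩
            change E x' ∈ s
            rw [hEφ _ hx]
            exact hx'
      _ = μ₂ (Subtype.val '' (Subtype.val ⁻¹' s : Set X₂')) := e
      _ = μ₂ s := by
          refine measure_congr ?_
          filter_upwards [ae₂] with y hy
          refine propext ⟨?_, fun h => ⟨⟨y, s₂ y hy⟩, h, rfl⟩⟩
          rintro ⟨y', hy', rfl⟩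
          exact hy'
  refine ⟨Φ, E, J, hmp, hJ, fun g => ?_, ?_⟩
  · filter_upwards [ae₁, (hinv g).quasiMeasurePreserving.ae ae₁] with x hx hgx
    obtain ⟨_, e⟩ := heq g ⟨x, s₁ x hx⟩
    rw [hEφ _ hgx, hEφ _ hx, ← e]
  · filter_upwards [ae₁, hmp.quasiMeasurePreserving.ae ae₂] with x hx hy
    have : J (E x) = φ.symm ⟨E x, s₂ _ hy⟩ := dif_pos hy
    rw [this]
    have : (⟨E x, s₂ _ hy⟩ : X₂') = φ ⟨x, s₁ x hx⟩ := Subtype.ext (hEφ x hx)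
    rw [this, φ.symm_apply_apply]

theorem measurePreserving_smul_bernoulliMeasure {G K : Type*} [Group G] [MeasurableSpace K]
    (κ : Measure K) [IsProbabilityMeasure κ] (g : G) :
    MeasurePreserving (fun x : BernoulliSpace G K => g • x) (bernoulliMeasure G κ)
      (bernoulliMeasure G κ) :=
  measurePreserving_infinitePi_comp κ (mul_right_injective g⁻¹)

/-- Conjugate Bernoulli shifts: up to relabelling the coordinates, the conjugacy is the
equivariant map with coordinate `ψ` at the identity, and it is inverted by `J`. -/
theorem ConjugateUpToAutomorphisms.exists_coordinate {G K₁ K₂ : Type*} [Group G] [Countable G]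
    [MeasurableSpace K₁] [MeasurableSpace K₂] {κ₁ : Measure K₁} [IsProbabilityMeasure κ₁]
    {κ₂ : Measure K₂} [IsProbabilityMeasure κ₂]
    (h : ConjugateUpToAutomorphisms G G (bernoulliMeasure G κ₁) (bernoulliMeasure G κ₂)) :
    ∃ (ψ : (G → K₁) → K₂) (J : (G → K₂) → G → K₁), Measurable ψ ∧ Measurable J ∧
      MeasurePreserving (fun (z : G → K₁) (g : G) => ψ fun h => z (g * h))
        (Measure.infinitePi fun _ => κ₁) (Measure.infinitePi fun _ => κ₂) ∧
      ∀ᵐ z ∂(Measure.infinitePi fun _ : G => κ₁), J (fun g => ψ fun h => z (g * h)) = z := by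
  have n₁ : Nonempty K₁ := nonempty_of_isProbabilityMeasure κ₁
  have n₂ : Nonempty K₂ := nonempty_of_isProbabilityMeasure κ₂
  have : Nonempty (BernoulliSpace G K₁) := inferInstanceAs (Nonempty (G → K₁))
  have : Nonempty (BernoulliSpace G K₂) := inferInstanceAs (Nonempty (G → K₂))
  obtain ⟨Φ, E, J, hE, hJ, heq, hJE⟩ :=
    h.exists_measurePreserving (measurePreserving_smul_bernoulliMeasure κ₁)
  let E' : (G → K₁) → G → K₂ := E
  let J' : (G → K₂) → G → K₁ := J
  have hE' : MeasurePreserving E' (Measure.infinitePi fun _ => κ₁)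
    (Measure.infinitePi fun _ => κ₂) := hE
  have hJ' : Measurable J' := hJ
  let ψ : (G → K₁) → K₂ := fun z => E' z 1
  have hψ : Measurable ψ := (measurable_pi_apply 1).comp hE'.measurable
  have key : ∀ᵐ z ∂(Measure.infinitePi fun _ : G => κ₁),
      (fun g => ψ fun h => z (g * h)) = fun g => E' z (Φ g) := by
    -- Equivariance under g⁻¹, evaluated at the identity. Countability of `G` gives one null set for
    -- all g.
    have : ∀ᵐ z ∂(Measure.infinitePi fun _ : G => κ₁), ∀ g,
        E' (fun h => z (g * h)) 1 = E' z (Φ g) := by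
      refine ae_all_iff.2 fun g => ?_
      filter_upwards [heq g⁻¹] with z hz
      have e1 : E (fun h => z (g⁻¹⁻¹ * h)) 1 = E z ((Φ g⁻¹)⁻¹ * 1) := congrFun hz 1
      rwa [map_inv, inv_inv, inv_inv, mul_one] at e1
    filter_upwards [this] with z hz
    exact funext hz
  have hmeas : Measurable fun (z : G → K₁) (g : G) => ψ fun h => z (g * h) :=
    measurable_pi_lambda _ fun g => hψ.comp (by fun_prop)
  -- The automorphism only permutes coordinates, which preserves the product measure; the inverse
  -- map undoes the permutation first.
  refine ⟨ψ, fun y => J' fun g => y (Φ.symm g), hψ, hJ'.comp (by fun_prop), ⟨hmeas, ?_⟩, ?_⟩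
  · rw [Measure.map_congr key]
    exact ((measurePreserving_infinitePi_comp κ₂ Φ.injective).comp hE').map_eq
  · filter_upwards [key, hJE] with z hz hz'
    have e : (fun g => E' z (Φ (Φ.symm g))) = E' z := by simp
    calc J' (fun g => ψ fun h => z (Φ.symm g * h)) = J' fun g => E' z (Φ (Φ.symm g)) :=
          congrArg J' (funext fun g => congrFun hz (Φ.symm g))
      _ = z := by rw [e]; exact hz'

end Conjugacy

/-! ### Choice of code and decoder, and comparison of entropies -/

section Comparison

/-- A strictly positive kernel on a finite type, nearly concentrated on the diagonal. -/
theorem exists_pos_kernel (A : Type*) [Fintype A] {δ : ℝ} (hδ : 0 < δ) :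
    ∃ ρ : A → A → ℝ, (∀ s t, 0 < ρ s t) ∧ (∀ t, ∑ s, ρ s t ≤ 1) ∧
      ∀ s, -Real.log (ρ s s) = δ := by
  classical
  rcases isEmpty_or_nonempty A with hA | hA
  · exact ⟨fun _ _ => 1, by simp, by simp, fun s => isEmptyElim s⟩
  have hN : (0 : ℝ) < Fintype.card A := by exact_mod_cast Fintype.card_pos
  have he : Real.exp (-δ) < 1 := by
    rw [← Real.exp_zero]
    exact Real.exp_lt_exp.2 (by linarith)
  have hc : 0 < (1 - Real.exp (-δ)) / Fintype.card A := div_pos (by linarith) hN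
  refine ⟨fun s t => if s = t then Real.exp (-δ) else (1 - Real.exp (-δ)) / Fintype.card A,
    fun s t => ?_, fun t => ?_, fun s => by simp⟩
  · dsimp only
    split_ifs
    · exact Real.exp_pos _
    · exact hc
  · calc ∑ s, (if s = t then Real.exp (-δ) else (1 - Real.exp (-δ)) / Fintype.card A)
        ≤ ∑ s, ((if s = t then Real.exp (-δ) else 0) + (1 - Real.exp (-δ)) / Fintype.card A) := by
          refine Finset.sum_le_sum fun s _ => ?_
          split_ifs <;> linarith
      _ = 1 := by
          rw [Finset.sum_add_distrib, Finset.sum_ite_eq' Finset.univ t, Finset.sum_const,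
            Finset.card_univ, nsmul_eq_mul]
          simp only [Finset.mem_univ, if_true]
          field_simp
          ring

/-- A probability measure carried by a countable set is nearly carried by finitely many atoms. -/
theorem exists_finset_atoms {K : Type*} [MeasurableSpace K] [MeasurableSingletonClass K]
    (κ : Measure K) [IsProbabilityMeasure κ] {K' : Set K} (hc : K'.Countable) (h1 : κ K' = 1) :
    ∃ k₀, 0 < κ.real {k₀} ∧ ∀ ε > 0, ∃ B : Finset K, k₀ ∈ B ∧ (∀ k ∈ B, 0 < κ.real {k}) ∧
      κ.real (B : Set K)ᶜ < ε := by
  classical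
  let D : Set K := {k ∈ K' | κ {k} ≠ 0}
  have hD : D.Countable := hc.mono fun k hk => hk.1
  have hDm : MeasurableSet D := hD.measurableSet
  have hpos : ∀ k ∈ D, 0 < κ.real {k} := fun k hk =>
    ENNReal.toReal_pos hk.2 (measure_ne_top _ _)
  have hnull : κ (K' \ D) = 0 := by
    have : K' \ D = ⋃ k ∈ K' \ D, {k} := (Set.biUnion_of_singleton _).symm
    rw [this, measure_biUnion_null_iff (hc.mono Set.sdiff_subset)]
    intro k hk
    by_contra h
    exact hk.2 ⟨hk.1, h⟩
  have hD1 : κ D = 1 := by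
    refine le_antisymm prob_le_one ?_
    calc 1 = κ K' := h1.symm
      _ ≤ κ (D ∪ K' \ D) := measure_mono fun k hk => by
          by_cases h : k ∈ D
          · exact Or.inl h
          · exact Or.inr ⟨hk, h⟩
      _ ≤ κ D + κ (K' \ D) := measure_union_le _ _
      _ = κ D := by rw [hnull, add_zero]
  have hne : D.Nonempty := by
    by_contra h
    rw [Set.not_nonempty_iff_eq_empty.1 h] at hD1
    simp at hD1
  obtain ⟨k₀, hk₀⟩ := hne
  refine ⟨k₀, hpos k₀ hk₀, fun ε hε => ?_⟩
  have : Countable D := hD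
  have hU : (⋃ s : Finset D, ((s.map (Function.Embedding.subtype _) : Finset K) : Set K)) = D := by
    ext k
    simp only [Set.mem_iUnion, Finset.mem_coe, Finset.mem_map, Function.Embedding.subtype_apply]
    constructor
    · rintro ⟨s, d, -, rfl⟩
      exact d.2
    · exact fun h => ⟨{⟨k, h⟩}, ⟨k, h⟩, by simp⟩
  have ht := tendsto_measure_iUnion_atTop (μ := κ)
    (s := fun s : Finset D => ((s.map (Function.Embedding.subtype _) : Finset K) : Set K))
    (fun s t hst => Finset.coe_subset.2 (Finset.map_subset_map.2 hst))
  rw [hU, hD1] at ht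
  have ht' := (ENNReal.tendsto_toReal ENNReal.one_ne_top).comp ht
  have hev := ht'.eventually (lt_mem_nhds (show 1 - ε < (1 : ℝ≥0∞).toReal by simpa using hε))
  obtain ⟨s, hs, hs0⟩ := (hev.and (eventually_ge_atTop ({⟨k₀, hk₀⟩} : Finset D))).exists
  refine ⟨s.map (Function.Embedding.subtype _), ?_, ?_, ?_⟩
  · exact Finset.mem_map.2 ⟨⟨k₀, hk₀⟩, hs0 (Finset.mem_singleton_self _), rfl⟩
  · intro k hk
    obtain ⟨d, -, rfl⟩ := Finset.mem_map.1 hk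
    exact hpos _ d.2
  · rw [probReal_compl_eq_one_sub (Finset.measurableSet _)]
    change 1 - ε < κ.real _ at hs
    linarith

/-- Collapsing all but finitely many letters to one of them increases the entropy by a small
amount only. -/
theorem integral_neg_log_collapse_le {K : Type*} [MeasurableSpace K] [MeasurableSingletonClass K]
    (κ : Measure K) [IsProbabilityMeasure κ] {B : Finset K} {k₀ : K} (hk₀ : k₀ ∈ B)
    {b : K → B} (hb : Measurable b) (hbB : ∀ k ∈ B, (b k : K) = k)
    (hbk : ∀ k ∉ B, (b k : K) = k₀) :
    ∫ k, -Real.log (κ.real {(b k : K)}) ∂κ ≤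
      ∑ k ∈ B, Real.negMulLog (κ.real {k})
        + κ.real (B : Set K)ᶜ * -Real.log (κ.real {k₀}) := by
  classical
  rw [integral_comp_eq_sum κ hb fun r => -Real.log (κ.real {(r : K)})]
  -- Only the letter `k₀` gains mass from the collapse, and at most the mass outside `B`.
  have h1 : ∀ r : B, κ.real (b ⁻¹' {r}) ≤
      κ.real {(r : K)} + if r = ⟨k₀, hk₀⟩ then κ.real (B : Set K)ᶜ else 0 := by
    intro r
    split_ifs with h
    · refine (measureReal_mono ?_).trans (measureReal_union_le _ _)
      rintro k rfl
      by_cases hk : k ∈ B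
      · exact Or.inl (hbB k hk).symm
      · exact Or.inr hk
    · rw [add_zero]
      refine measureReal_mono ?_
      rintro k rfl
      by_cases hk : k ∈ B
      · exact (hbB k hk).symm
      · exact absurd (Subtype.ext (hbk k hk)) h
  have hn : ∀ r : K, 0 ≤ -Real.log (κ.real {r}) := fun r =>
    neg_nonneg.2 (Real.log_nonpos measureReal_nonneg measureReal_le_one)
  calc _ ≤ ∑ r : B, (κ.real {(r : K)} + if r = ⟨k₀, hk₀⟩ then κ.real (B : Set K)ᶜ else 0)
          * -Real.log (κ.real {(r : K)}) :=
        Finset.sum_le_sum fun r _ => mul_le_mul_of_nonneg_right (h1 r) (hn r)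
    _ = _ := by
        simp_rw [add_mul, ite_mul, zero_mul]
        rw [Finset.sum_add_distrib, Finset.sum_ite_eq' Finset.univ]
        simp only [Finset.mem_univ, if_true]
        congr 1
        rw [← Finset.sum_coe_sort B fun k => Real.negMulLog (κ.real {k})]
        exact Finset.sum_congr rfl fun r _ => by rw [Real.negMulLog]; ring

/-- The partial entropies of `κ₁` are bounded by the entropy of `κ₂` when the Bernoulli shifts are
conjugate: code the `κ₁`-labellings of a finite model by finitely many letters of `K₂`. -/
theorem sum_negMulLog_le_of_conjugate {G : Type*} [Group G] [Countable G] (hG : IsSofic G)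
    {K₁ K₂ : Type*} [MeasurableSpace K₁] [MeasurableSingletonClass K₁]
    [MeasurableSpace K₂] [MeasurableSingletonClass K₂]
    {κ₁ : Measure K₁} [IsProbabilityMeasure κ₁] {κ₂ : Measure K₂} [IsProbabilityMeasure κ₂]
    (hconj : ConjugateUpToAutomorphisms G G (bernoulliMeasure G κ₁) (bernoulliMeasure G κ₂))
    {K' : Set K₂} (hc : K'.Countable) (hK' : κ₂ K' = 1) {H : ℝ}
    (hH : ∀ B : Finset K₂, ∑ k ∈ B, Real.negMulLog (κ₂.real {k}) ≤ H)
    {Q : Finset K₁} (hQ : ∀ k ∈ Q, 0 < κ₁.real {k}) :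
    ∑ k ∈ Q, Real.negMulLog (κ₁.real {k}) ≤ H := by
  classical
  obtain ⟨ψ, J, hψ, hJ, hE, hJE⟩ := hconj.exists_coordinate
  set μ₁ := Measure.infinitePi fun _ : G => κ₁ with hμ₁
  set μ₂ := Measure.infinitePi fun _ : G => κ₂ with hμ₂
  set E : (G → K₁) → G → K₂ := fun z g => ψ fun h => z (g * h)
  let _ : MeasurableSpace (Option Q) := ⊤
  have : MeasurableSingletonClass (Option Q) := ⟨fun _ => trivial⟩
  let a : K₁ → Option Q := fun k => if h : k ∈ Q then some ⟨k, h⟩ else none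
  have ha_some : ∀ q : Q, a ⁻¹' {some q} = {(q : K₁)} := by
    intro q
    ext k
    simp only [a, Set.mem_preimage, Set.mem_singleton_iff]
    split_ifs with h
    · simp [Subtype.ext_iff]
    · simp only [false_iff]
      rintro rfl
      exact h q.2
  have ha : Measurable a := by
    have hQm : MeasurableSet {k | k ∈ Q} := Finset.measurableSet Q
    refine Measurable.dite (s := {k | k ∈ Q}) (f := fun q : Q => some q) (g := fun _ => none)
      (measurable_of_finite _) measurable_const hQm
  -- Gibbs' inequality needs only a majorant of the law. Weight 1 on `none` costs log 1 = 0, so the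
  -- left side is exactly the partial entropy over `Q`.
  let p : Option Q → ℝ := fun s => s.elim 1 fun q => κ₁.real {(q : K₁)}
  have hp : ∀ s, 0 < p s := by
    rintro (_ | q)
    · exact one_pos
    · exact hQ q q.2
  have hap : ∀ s, κ₁.real (a ⁻¹' {s}) ≤ p s := by
    rintro (_ | q)
    · exact measureReal_le_one
    · rw [ha_some]; exact le_rfl
  have hleft : ∫ k, -Real.log (p (a k)) ∂κ₁ = ∑ k ∈ Q, Real.negMulLog (κ₁.real {k}) := by
    rw [integral_comp_eq_sum κ₁ ha fun s => -Real.log (p s), Fintype.sum_option,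
      ← Finset.sum_coe_sort Q fun k => Real.negMulLog (κ₁.real {k})]
    simp only [ha_some, p, Option.elim, Real.log_one, neg_zero, mul_zero, zero_add]
    exact Finset.sum_congr rfl fun r _ => by rw [Real.negMulLog]; ring
  refine le_of_forall_pos_le_add fun δ' hδ' => ?_
  -- Five errors of at most `δ` will be added. Each tolerance depends only on earlier choices: `ρ`
  -- and `L₀`, then `T`, then `B` and `C`, then `W`, then the model.
  obtain ⟨δ, hδ, hδδ⟩ : ∃ δ : ℝ, 0 < δ ∧ δ' = 6 * δ := ⟨δ' / 6, by positivity, by ring⟩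
  obtain ⟨ρ, hρ, hρ1, hρd⟩ := exists_pos_kernel (Option Q) hδ
  obtain ⟨L₀, hL₀⟩ := (Set.finite_range fun z : Option Q × Option Q =>
    -Real.log (ρ z.1 z.2)).bddAbove
  have hL : ∀ s t, -Real.log (ρ s t) ≤ L₀ := fun s t => hL₀ ⟨(s, t), rfl⟩
  have hρn : ∀ s t, 0 ≤ -Real.log (ρ s t) := fun s t =>
    neg_nonneg.2 (Real.log_nonpos (hρ s t).le ((Finset.single_le_sum (f := fun s => ρ s t)
      (fun s _ => (hρ s t).le) (Finset.mem_univ s)).trans (hρ1 t)))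
  have hL0 : 0 ≤ L₀ := (hρn none none).trans (hL none none)
  let θ : (G → K₂) → Option Q := fun y => a (J y 1)
  have hθ : Measurable θ := ha.comp ((measurable_pi_apply 1).comp hJ)
  obtain ⟨T, c₂, hc₂, hc₂T, hc₂θ⟩ := exists_dependsOn_measureReal_ne_lt μ₂ hθ
    (show 0 < δ / (L₀ + 1) by positivity)
  obtain ⟨k₀, hk₀, hatoms⟩ := exists_finset_atoms κ₂ hc hK'
  set C₀ := -Real.log (κ₂.real {k₀}) with hC₀
  have hC₀n : 0 ≤ C₀ := neg_nonneg.2 (Real.log_nonpos measureReal_nonneg measureReal_le_one)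
  obtain ⟨B, hk₀B, hB, hBc⟩ := hatoms (δ / (T.card * L₀ + C₀ + 1)) (by positivity)
  set e₂ := κ₂.real (B : Set K₂)ᶜ with he₂
  let b : K₂ → B := fun k => if h : k ∈ B then ⟨k, h⟩ else ⟨k₀, hk₀B⟩
  have hbB : ∀ k ∈ B, (b k : K₂) = k := fun k hk => by simp [b, hk]
  have hbk : ∀ k ∉ B, (b k : K₂) = k₀ := fun k hk => by simp [b, hk]
  have hb : Measurable b := by
    have hBm : MeasurableSet {k | k ∈ B} := Finset.measurableSet B
    refine Measurable.dite (s := {k | k ∈ B}) (f := fun q : B => q)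
      (g := fun _ => ⟨k₀, hk₀B⟩) (measurable_of_finite _) measurable_const hBm
  let w : B → ℝ := fun r => κ₂.real {(r : K₂)}
  have hw : ∀ r, 0 < w r := fun r => hB r r.2
  have hw1 : ∑ r, w r ≤ 1 := by
    rw [Finset.sum_coe_sort B fun k => κ₂.real {k}, sum_measureReal_singleton]
    exact measureReal_le_one
  obtain ⟨C, hC'⟩ := (Set.finite_range fun r : B => -Real.log (w r)).bddAbove
  have hC : ∀ r, -Real.log (w r) ≤ C := fun r => hC' ⟨r, rfl⟩
  have hwn : ∀ r, 0 ≤ -Real.log (w r) := fun r =>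
    neg_nonneg.2 (Real.log_nonpos measureReal_nonneg measureReal_le_one)
  have hC0 : 0 ≤ C := (hwn ⟨k₀, hk₀B⟩).trans (hC _)
  have hbψ : Measurable fun z => b (ψ z) := hb.comp hψ
  obtain ⟨W, c, hcm, hcW, hcψ⟩ := exists_dependsOn_measureReal_ne_lt μ₁ hbψ
    (show 0 < δ / (T.card * L₀ + C + 1) by positivity)
  set e₃ := μ₁.real {z | c z ≠ b (ψ z)} with he₃
  -- The filler `k₀` outside `T` is harmless because `c₂` depends only on coordinates in `T`.
  let f : (T → B) → Option Q := fun r => c₂ fun h => if hh : h ∈ T then (r ⟨h, hh⟩ : K₂) else k₀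
  have hψκ : MeasurePreserving ψ μ₁ κ₂ := by
    have h1 := (measurePreserving_eval_infinitePi (fun _ : G => κ₂) 1).comp hE
    have h2 : Function.eval 1 ∘ E = ψ := by
      funext z
      simp [E]
    rwa [h2] at h1
  have hshift : ∀ g : G, MeasurePreserving (fun (z : G → K₁) h => z (g * h)) μ₁ μ₁ := fun g =>
    measurePreserving_infinitePi_comp κ₁ (mul_right_injective g)
  have hα : ∫ z, -Real.log (w (c z)) ∂μ₁ ≤ H + e₂ * C₀ + C * e₃ := by
    have h1 := integral_comp_le_add_of_ne μ₁ hcm hbψ hwn hC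
    have h2 : ∫ z, -Real.log (w (b (ψ z))) ∂μ₁ = ∫ k, -Real.log (w (b k)) ∂κ₂ := by
      rw [← hψκ.map_eq]
      exact (integral_map hψ.aemeasurable (((measurable_of_finite fun r => -Real.log (w r)).comp
        hb).aestronglyMeasurable)).symm
    have h3 := integral_neg_log_collapse_le κ₂ hk₀B hb hbB hbk
    have h4 := hH B
    linarith
  let D : (G → K₁) → Option Q := fun z => f fun g : T => c fun h => z (g * h)
  have hD : Measurable D := by
    have h : Measurable fun (z : G → K₁) (g : T) => c fun h => z (g * h) := by
      refine measurable_pi_lambda _ fun g => ?_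
      exact hcm.comp (hshift g).measurable
    exact (measurable_of_finite f).comp h
  have haz : Measurable fun z : G → K₁ => a (z 1) := ha.comp (measurable_pi_apply 1)
  have herr : μ₁.real {z | (a (z 1), D z) ≠ (a (z 1), a (z 1))} ≤
      δ / (L₀ + 1) + T.card * (e₂ + e₃) := by
    let N₀ : Set (G → K₁) := {z | J (E z) ≠ z}
    let N₁ : Set (G → K₁) := E ⁻¹' {y | c₂ y ≠ θ y}
    let N₂ : G → Set (G → K₁) := fun g => (fun z h => z (g * h)) ⁻¹' (ψ ⁻¹' (B : Set K₂)ᶜ)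
    let N₃ : G → Set (G → K₁) := fun g => (fun z h => z (g * h)) ⁻¹' {z | c z ≠ b (ψ z)}
    -- Decoding can fail only if `J` fails to invert `E`, if `c₂` differs from the exact decoder, or
    -- if at some site of `T` the `K₂`-letter leaves `B` or is miscoded by `c`.
    have hsub : {z | (a (z 1), D z) ≠ (a (z 1), a (z 1))} ⊆
        N₀ ∪ N₁ ∪ ⋃ g ∈ T, (N₂ g ∪ N₃ g) := by
      intro z hz
      by_contra hn
      simp only [Set.mem_union, Set.mem_iUnion, not_or, not_exists] at hn
      obtain ⟨⟨h0, h1⟩, h23⟩ := hn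
      have h0' : J (E z) = z := not_not.1 h0
      have h1' : c₂ (E z) = θ (E z) := not_not.1 h1
      apply hz
      refine Prod.ext rfl ?_
      change c₂ _ = a (z 1)
      have : a (z 1) = c₂ (E z) := by rw [h1']; simp only [θ, h0']
      rw [this]
      refine hc₂T fun g hg => ?_
      have hg' : g ∈ T := hg
      obtain ⟨h2, h3⟩ := h23 g hg'
      have h2' : ψ (fun h => z (g * h)) ∈ B := by
        by_contra h
        exact h2 h
      have h3' : c (fun h => z (g * h)) = b (ψ fun h => z (g * h)) := not_not.1 h3
      simp only [dif_pos hg', h3', hbB _ h2', E]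
    have m0 : μ₁.real N₀ = 0 := by
      rw [measureReal_eq_zero_iff]
      exact hJE
    have m1 : μ₁.real N₁ ≤ δ / (L₀ + 1) := by
      have : MeasurableSet {y | c₂ y ≠ θ y} := (measurableSet_eq_fun hc₂ hθ).compl
      rw [show μ₁.real N₁ = μ₂.real {y | c₂ y ≠ θ y} from
        hE.measureReal_preimage this.nullMeasurableSet]
      exact hc₂θ.le
    have m2 : ∀ g, μ₁.real (N₂ g) = e₂ := fun g => by
      have hm : MeasurableSet (B : Set K₂)ᶜ := (Finset.measurableSet B).compl
      exact ((hshift g).measureReal_preimage (hψ hm).nullMeasurableSet).trans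
        (hψκ.measureReal_preimage hm.nullMeasurableSet)
    have m3 : ∀ g, μ₁.real (N₃ g) = e₃ := fun g => by
      have hm : MeasurableSet {z | c z ≠ b (ψ z)} := (measurableSet_eq_fun hcm hbψ).compl
      exact (hshift g).measureReal_preimage hm.nullMeasurableSet
    calc _ ≤ μ₁.real (N₀ ∪ N₁ ∪ ⋃ g ∈ T, (N₂ g ∪ N₃ g)) := measureReal_mono hsub
      _ ≤ (μ₁.real N₀ + μ₁.real N₁) + μ₁.real (⋃ g ∈ T, (N₂ g ∪ N₃ g)) :=
          (measureReal_union_le _ _).trans (by gcongr; exact measureReal_union_le _ _)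
      _ ≤ (0 + δ / (L₀ + 1)) + ∑ g ∈ T, (e₂ + e₃) := by
          rw [m0]
          gcongr
          refine (measureReal_biUnion_finset_le _ _).trans (Finset.sum_le_sum fun g _ => ?_)
          refine (measureReal_union_le _ _).trans ?_
          rw [m2, m3]
      _ = _ := by rw [Finset.sum_const, nsmul_eq_mul, zero_add]
  have hβ : ∫ z, -Real.log (ρ (a (z 1)) (D z)) ∂μ₁ ≤
      δ + L₀ * (δ / (L₀ + 1) + T.card * (e₂ + e₃)) := by
    have h1 := integral_comp_le_add_of_ne μ₁ (haz.prodMk hD) (haz.prodMk haz)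
      (u := fun z => -Real.log (ρ z.1 z.2)) (fun z => hρn _ _) (fun z => hL _ _)
    simp only [hρd, integral_const, probReal_univ, smul_eq_mul, one_mul] at h1
    exact h1.trans (by gcongr)
  let S : Finset G := {1} ∪ T ∪ W ∪ Finset.image₂ (· * ·) T W
  obtain ⟨m, σ, hm, F, ε, hFmono, hFU, hε, hσ⟩ := hG
  have hFmono' : Monotone F := monotone_nat_of_le_succ hFmono
  have hFS : ∀ᶠ i in atTop, ∀ s ∈ S, s⁻¹ ∈ F i := by
    refine (Finset.eventually_all S).2 fun s _ => ?_
    obtain ⟨i, hi⟩ := Set.mem_iUnion.1 (hFU ▸ Set.mem_univ s⁻¹ : s⁻¹ ∈ ⋃ i, F i)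
    exact eventually_atTop.2 ⟨i, fun j hj => hFmono' hj hi⟩
  have hεsmall : ∀ᶠ i in atTop, ε i < δ / (C + L₀ + 1) :=
    hε.eventually (gt_mem_nhds (by positivity))
  obtain ⟨i, hi, hεi⟩ := (hFS.and hεsmall).exists
  have main := mul_integral_neg_log_le_of_code κ₁ ha hp hap hw hw1 hρ hρ1 hC hL hcm hcW f
    (S := (S : Set G)) (by simp [S]) (fun g hg => by simp [S, hg]) (fun g hg => by simp [S, hg])
    (fun g hg h hh => by
      have : g * h ∈ Finset.image₂ (· * ·) T W := Finset.mem_image₂_of_mem hg hh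
      exact Finset.mem_coe.2 (Finset.mem_union_right _ this))
    (σ i) (fun s hs => hi s hs) (hσ i)
  rw [hleft] at main
  have hmpos : (0 : ℝ) < m i := by exact_mod_cast hm i
  have main' : ∑ k ∈ Q, Real.negMulLog (κ₁.real {k}) ≤
      (∫ z, -Real.log (w (c z)) ∂μ₁ + ∫ z, -Real.log (ρ (a (z 1)) (D z)) ∂μ₁)
        + ε i * (C + L₀) := by
    refine le_of_mul_le_mul_left (main.trans_eq ?_) hmpos
    change _ * (_ + ∫ z, -Real.log (ρ (a (z 1)) (D z)) ∂μ₁) + _ = _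
    ring
  -- No sign is assumed on `x`, since `ε i` may be negative.
  have small : ∀ {x d : ℝ}, 0 ≤ d → x < δ / (d + 1) → x * d ≤ δ := by
    intro x d hd hx
    rw [lt_div_iff₀ (by linarith)] at hx
    rcases le_or_gt 0 x with h | h
    · linarith
    · nlinarith
  have s1 := small (by positivity) hBc
  have s2 := small (by positivity) hcψ
  have s3 := small (by positivity) hεi
  have s4 : δ / (L₀ + 1) * L₀ ≤ δ := by
    rw [div_mul_eq_mul_div, div_le_iff₀ (by linarith)]
    nlinarith
  rw [hδδ]
  linarith

/-- The entropy is the supremum of its finite partial sums, from which null points can be dropped.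
Finiteness guarantees that both measures have countable carriers, so that both entropies are given
by the sums. -/
theorem baseEntropy_le_of_conjugate {G : Type*} [Group G] [Countable G] (hG : IsSofic G)
    {K₁ K₂ : Type*} [MeasurableSpace K₁] [MeasurableSingletonClass K₁]
    [MeasurableSpace K₂] [MeasurableSingletonClass K₂]
    {κ₁ : Measure K₁} [IsProbabilityMeasure κ₁] {κ₂ : Measure K₂} [IsProbabilityMeasure κ₂]
    (h₁ : baseEntropy κ₁ ≠ ⊤) (h₂ : baseEntropy κ₂ ≠ ⊤)
    (hconj : ConjugateUpToAutomorphisms G G (bernoulliMeasure G κ₁) (bernoulliMeasure G κ₂)) :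
    baseEntropy κ₁ ≤ baseEntropy κ₂ := by
  classical
  have c₁ : ∃ K' : Set K₁, K'.Countable ∧ κ₁ K' = 1 := by
    by_contra h
    exact h₁ (if_neg h)
  have c₂ : ∃ K' : Set K₂, K'.Countable ∧ κ₂ K' = 1 := by
    by_contra h
    exact h₂ (if_neg h)
  have e₁ : baseEntropy κ₁ = ∑' k, ENNReal.ofReal (Real.negMulLog (κ₁.real {k})) := if_pos c₁
  have e₂ : baseEntropy κ₂ = ∑' k, ENNReal.ofReal (Real.negMulLog (κ₂.real {k})) := if_pos c₂
  obtain ⟨K', hc, hK'⟩ := c₂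
  rw [e₁]
  refine ENNReal.summable.tsum_le_of_sum_le fun Q => ?_
  rw [← ENNReal.ofReal_sum_of_nonneg fun k _ => Real.negMulLog_nonneg measureReal_nonneg
    measureReal_le_one, ← ENNReal.ofReal_toReal h₂]
  refine ENNReal.ofReal_le_ofReal ?_
  have hQ : ∑ k ∈ Q, Real.negMulLog (κ₁.real {k})
      = ∑ k ∈ Q.filter (fun k => 0 < κ₁.real {k}), Real.negMulLog (κ₁.real {k}) := by
    refine (Finset.sum_filter_of_ne fun k _ hk => ?_).symm
    refine lt_of_le_of_ne measureReal_nonneg fun h => hk ?_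
    rw [← h, Real.negMulLog_zero]
  rw [hQ]
  refine sum_negMulLog_le_of_conjugate hG hconj hc hK' (fun B => ?_)
    fun k hk => (Finset.mem_filter.1 hk).2
  rw [← ENNReal.ofReal_le_iff_le_toReal h₂, ENNReal.ofReal_sum_of_nonneg fun k _ =>
    Real.negMulLog_nonneg measureReal_nonneg measureReal_le_one, e₂]
  exact ENNReal.sum_le_tsum B

end Comparison

theorem mainTheorem6 {G : Type*} [Group G] [Countable G] (hG : IsSofic G)
    {K₁ K₂ : Type*} [MeasurableSpace K₁] [StandardBorelSpace K₁]
    [MeasurableSpace K₂] [StandardBorelSpace K₂]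
    (κ₁ : Measure K₁) [IsProbabilityMeasure κ₁] (κ₂ : Measure K₂) [IsProbabilityMeasure κ₂]
    (hfin : baseEntropy κ₁ + baseEntropy κ₂ < ⊤)
    (hconj : ConjugateUpToAutomorphisms G G (bernoulliMeasure G κ₁) (bernoulliMeasure G κ₂)) :
    baseEntropy κ₁ = baseEntropy κ₂ := by
  obtain ⟨h₁, h₂⟩ := ENNReal.add_ne_top.1 hfin.ne
  exact le_antisymm (baseEntropy_le_of_conjugate hG h₁ h₂ hconj)
    (baseEntropy_le_of_conjugate hG h₂ h₁ hconj.symm)
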